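/- Let $0<q<1$ and $\alpha,\beta>-1$ be real. Write $(a;q)_\infty=\prod_{i\ge0}(1-aq^i)$, $(a;q)_s=(a;q)_\infty/(aq^s;q)_\infty$, $[k]_q=\frac{1-q^k}{1-q}$, $D_qf(x)=\frac{f(x)-f(qx)}{(1-q)x}$, $\int_0^1f(x)\,d_qx=(1-q)\sum_{n\ge0}q^nf(q^n)$ and $\omega^{(\alpha,\beta)}(x;q)=(qx;q)_\beta\,x^\alpha$. There is a unique sequence of monic real polynomials $p_n^{(\alpha,\beta)}$ (the monic little $q$-Jacobi polynomials) with $\deg p_n^{(\alpha,\beta)}=n$ and $$\int_0^1p_n^{(\alpha,\beta)}(x)\,x^k\,\omega^{(\alpha,\beta)}(x;q)\,d_qx=0\qquad(0\le k\le n-1);$$ let $h_n^{(\alpha,\beta)}=\int_0^1p_n^{(\alpha,\beta)}(x)^2\,\omega^{(\alpha,\beta)}(x;q)\,d_qx$ be its norms. On real polynomials consider the skew symmetric form $$\langle f,g\rangle_s=\int_0^1\bigl(f(x)D_qg(x)-g(x)D_qf(x)\bigr)\,\omega^{(\alpha+1,\beta+1)}(x;q)\,d_qx .$$ For $m\ge0$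 put $$Q_{2m+1}=p^{(\alpha,\beta)}_{2m+1},\qquad Q_{2m}=\sum_{j=0}^{m}\left(\prod_{k=1}^{m-j}\frac{[2m-2k+2]_q\,h_{2m-2k+1}^{(\alpha+1,\beta+1)}+q^{\beta+1}[2m-2k+1]_q\,h_{2m-2k+2}^{(\alpha,\beta)}}{[2m-2k+1]_q\,h_{2m-2k}^{(\alpha+1,\beta+1)}+q^{\beta+1}[2m-2k]_q\,h_{2m-2k+1}^{(\alpha,\beta)}}\right)p^{(\alpha,\beta)}_{2j}.$$ Then each $Q_n$ is monic of degree $n$, and there are nonzero constants $u_n$ such that for all $m,n\ge0$ $$\langle Q_{2n},Q_{2m+1}\rangle_s=-\langle Q_{2m+1},Q_{2n}\rangle_s=u_n\delta_{n,m},\qquad\langle Q_{2m},Q_{2n}\rangle_s=\langle Q_{2m+1},Q_{2n+1}\rangle_s=0 .$$ Moreover, a sequence $(\widetilde Q_n)_{n\ge0}$ of monic real polynomials with $\deg\widetilde Q_n=n$ satisfies these relations for some constants $(u_n)$ if and only if, for every $m$, $\widetilde Q_{2m}=Q_{2m}$ and $\widetilde Q_{2m+1}=p^{(\alpha,\beta)}_{2m+1}+\gamma_mQ_{2m}$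 for some real constant $\gamma_m$. -/

import Mathlib

open Polynomial

noncomputable section

namespace LittleQJacobi

/-- The infinite `q`-shifted factorial `(a;q)_∞ = ∏_{i ≥ 0} (1 - a q^i)`. -/
def qPochInf (a q : ℝ) : ℝ := ∏' i : ℕ, (1 - a * q ^ i)

/-- `(a;q)_s = (a;q)_∞ / (a q^s;q)_∞` for a real index `s`. -/
def qPoch (a q s : ℝ) : ℝ := qPochInf a q / qPochInf (a * q ^ s) q

/-- The `q`-number `[k]_q = (1 - q^k) / (1 - q)`. -/
def qNumber (q : ℝ) (k : ℕ) : ℝ := (1 - q ^ k) / (1 - q)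

/-- The `q`-difference operator `D_q f(x) = (f(x) - f(qx)) / ((1 - q) x)`. It is only ever
evaluated at the lattice points `x = q^n`, which are nonzero. -/
def qDiff (q : ℝ) (f : ℝ → ℝ) (x : ℝ) : ℝ := (f x - f (q * x)) / ((1 - q) * x)

/-- The Jackson integral `∫_0^1 f(x) d_q x = (1 - q) ∑_{n ≥ 0} q^n f(q^n)`. -/
def jackson (q : ℝ) (f : ℝ → ℝ) : ℝ := (1 - q) * ∑' n : ℕ, q ^ n * f (q ^ n)

/-- The little `q`-Jacobi weight `ω^{(α,β)}(x;q) = (qx;q)_β x^α`. -/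
def weight (q α β x : ℝ) : ℝ := qPoch (q * x) q β * x ^ α

/-- The symmetric form `∫_0^1 f(x) g(x) ω(x) d_q x` on polynomials. -/
def symmForm (q : ℝ) (ω : ℝ → ℝ) (f g : ℝ[X]) : ℝ :=
  jackson q fun x => f.eval x * g.eval x * ω x

/-- The skew symmetric form `∫_0^1 (f D_q g - g D_q f) ω d_q x` on polynomials. -/
def skewForm (q : ℝ) (ω : ℝ → ℝ) (f g : ℝ[X]) : ℝ :=
  jackson q fun x =>
    (f.eval x * qDiff q (fun y => g.eval y) x - g.eval x * qDiff q (fun y => f.eval y) x) * ω x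

/-- `p` consists of monic polynomials, `p n` of degree `n`, with
`∫_0^1 p_n(x) x^k ω(x) d_q x = 0` for `0 ≤ k ≤ n - 1`. -/
def IsMonicOrthogonal (q : ℝ) (ω : ℝ → ℝ) (p : ℕ → ℝ[X]) : Prop :=
  ∀ n, (p n).Monic ∧ (p n).natDegree = n ∧ ∀ k < n, symmForm q ω (p n) (X ^ k) = 0

/-- `Q` consists of monic polynomials, `Q n` of degree `n`, that are skew orthogonal with
normalisations `u`. -/
def IsMonicSkewOrthogonal (q : ℝ) (ω : ℝ → ℝ) (Q : ℕ → ℝ[X]) (u : ℕ → ℝ) : Prop :=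
  (∀ n, (Q n).Monic ∧ (Q n).natDegree = n) ∧
  ∀ m n,
    skewForm q ω (Q (2 * n)) (Q (2 * m + 1)) = (if n = m then u n else 0) ∧
    skewForm q ω (Q (2 * m + 1)) (Q (2 * n)) = -(if n = m then u n else 0) ∧
    skewForm q ω (Q (2 * m)) (Q (2 * n)) = 0 ∧
    skewForm q ω (Q (2 * m + 1)) (Q (2 * n + 1)) = 0

/-- The monic little `q`-Jacobi polynomials `p_n^{(α,β)}(x;q)`, built by orthogonalising
`1, x, x^2, …` against the weight `ω^{(α,β)}`. -/
def poly (q α β : ℝ) (n : ℕ) : ℝ[X] :=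
  X ^ n - ∑ k : Fin n,
    C (symmForm q (weight q α β) (X ^ n) (poly q α β k) /
      symmForm q (weight q α β) (poly q α β k) (poly q α β k)) * poly q α β k
termination_by n
decreasing_by all_goals exact k.2

/-- The norms `h_n^{(α,β)} = ∫_0^1 p_n^{(α,β)}(x;q)^2 ω^{(α,β)}(x;q) d_q x`. -/
def norm (q α β : ℝ) (n : ℕ) : ℝ :=
  symmForm q (weight q α β) (poly q α β n) (poly q α β n)

/-- The explicit even-degree polynomials. In the product `k ≤ m`, so that no natural-number
subtraction truncates. -/
def skewEven (q α β : ℝ) (m : ℕ) : ℝ[X] :=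
  ∑ j ∈ Finset.range (m + 1),
    C (∏ k ∈ Finset.Icc 1 (m - j),
      (qNumber q (2 * m - 2 * k + 2) * norm q (α + 1) (β + 1) (2 * m - 2 * k + 1) +
          q ^ (β + 1) * qNumber q (2 * m - 2 * k + 1) * norm q α β (2 * m - 2 * k + 2)) /
        (qNumber q (2 * m - 2 * k + 1) * norm q (α + 1) (β + 1) (2 * m - 2 * k) +
          q ^ (β + 1) * qNumber q (2 * m - 2 * k) * norm q α β (2 * m - 2 * k + 1))) *
      poly q α β (2 * j)

end LittleQJacobi

end

/-!
The skew form is a Wronskian: `⟨f, g⟩_s = L₁ (f * D_q g) - L₁ (g * D_q f)` with `L₁` the moment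
functional of `ω₁ = ω^{(α+1,β+1)}`. On the lattice `{q ^ n}` one has
`ω₁(x) = x (1 - q^(β+1) x) ω(x)`, and `ω₁` is also a multiple of `y (1 - y) ω(y)` at `y = q x`.
Summation by parts (the boundary term at `1` vanishes) therefore moves `D_q` off its argument at the
cost of raising the degree by one, with `L₁` replaced by the functional of `ω = ω^{(α,β)}`. Hence
the Gram matrix of the skew form in the basis `p_n` is tridiagonal, and the entries next to its
diagonal are computed from `D_q p_{n+1} = [n+1]_q p_n^{(α+1,β+1)}`; they are positive.

For a tridiagonal alternating form, skew Gram-Schmidt reduces to the two-term recursion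
`Q_{2m+2} = p_{2m+2} + c_m Q_{2m}`, `Q_{2m+1} = p_{2m+1}`, and unrolling it gives the product
formula. Since the form is nondegenerate on polynomials of degree less than `2 m`, the only freedom
left is to add a multiple of `Q_{2m}` to `Q_{2m+1}`.
-/

noncomputable section

namespace LittleQJacobi

section MonicSequences

variable {R : Type*} [CommRing R] {P Q : ℕ → R[X]}

theorem degree_lt_of_degree_le_of_coeff_eq_zero {f : R[X]} {n : ℕ} (hf : f.degree ≤ n)
    (h0 : f.coeff n = 0) : f.degree < n :=
  hf.lt_of_ne fun h => by simp [coeff_ne_zero_of_eq_degree h] at h0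

/-- A sequence of monic polynomials, the `n`-th one of degree `n`. -/
def IsMonicSeq (P : ℕ → R[X]) : Prop := ∀ n, (P n).Monic ∧ (P n).natDegree = n

theorem isMonicSeq_X_pow [Nontrivial R] : IsMonicSeq fun n => (X ^ n : R[X]) :=
  fun n => ⟨monic_X_pow n, natDegree_X_pow n⟩

theorem IsMonicSeq.coeff_self (hP : IsMonicSeq P) (n : ℕ) : (P n).coeff n = 1 := by
  simpa only [(hP n).2] using (hP n).1.coeff_natDegree

variable [Nontrivial R]

theorem IsMonicSeq.degree_eq (hP : IsMonicSeq P) (n : ℕ) : (P n).degree = n := by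
  rw [degree_eq_natDegree (hP n).1.ne_zero, (hP n).2]

theorem IsMonicSeq.degree_lt (hP : IsMonicSeq P) {k n : ℕ} (hk : k < n) : (P k).degree < n := by
  rw [hP.degree_eq]
  exact_mod_cast hk

theorem IsMonicSeq.of_degree_sub_lt (hP : IsMonicSeq P)
    (h : ∀ n : ℕ, (Q n - P n).degree < (n : WithBot ℕ)) : IsMonicSeq Q := by
  intro n
  have hlt : (Q n - P n).degree < (P n).degree := (h n).trans_eq (hP.degree_eq n).symm
  rw [← sub_add_cancel (Q n) (P n)]
  exact ⟨(hP n).1.add_of_right hlt, (natDegree_add_eq_right_of_degree_lt hlt).trans (hP n).2⟩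

theorem IsMonicSeq.degree_sub_lt (hP : IsMonicSeq P) (hQ : IsMonicSeq Q) (n : ℕ) :
    (P n - Q n).degree < n := by
  rw [← hP.degree_eq n]
  exact degree_sub_lt_left (by rw [hP.degree_eq, hQ.degree_eq]) (hP n).1.ne_zero
    ((hP n).1.trans (hQ n).1.symm)

theorem IsMonicSeq.degree_sub_C_coeff_mul_lt (hP : IsMonicSeq P) {f : R[X]} {n : ℕ}
    (hf : f.degree ≤ n) : (f - C (f.coeff n) * P n).degree < n := by
  refine degree_lt_of_degree_le_of_coeff_eq_zero ?_ ?_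
  · refine (degree_sub_le _ _).trans (max_le hf ?_)
    rw [← smul_eq_C_mul, ← hP.degree_eq n]
    exact degree_smul_le _ _
  · rw [coeff_sub, coeff_C_mul, hP.coeff_self, mul_one, sub_self]

theorem IsMonicSeq.map_eq_zero_of_degree_lt {M : Type*} [AddCommGroup M] [Module R M]
    (hP : IsMonicSeq P) {φ : R[X] →ₗ[R] M} {n : ℕ} (hφ : ∀ k < n, φ (P k) = 0) {f : R[X]}
    (hf : f.degree < n) : φ f = 0 := by
  let S : Polynomial.Sequence R := ⟨P, hP.degree_eq⟩
  have hspan : Submodule.span R (S '' Set.Iio n) = degreeLT R n :=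
    S.span_degreeLT fun i _ => by simp [S, (hP i).1.leadingCoeff]
  have hle : degreeLT R n ≤ LinearMap.ker φ := by
    rw [← hspan, Submodule.span_le]
    rintro _ ⟨k, hk, rfl⟩
    exact hφ k hk
  exact hle (mem_degreeLT.2 hf)

theorem IsMonicSeq.map_eq_coeff_smul {M : Type*} [AddCommGroup M] [Module R M]
    (hP : IsMonicSeq P) {φ : R[X] →ₗ[R] M} {n : ℕ} (hφ : ∀ k < n, φ (P k) = 0) {f : R[X]}
    (hf : f.degree ≤ n) : φ f = f.coeff n • φ (P n) := by
  have h := hP.map_eq_zero_of_degree_lt hφ (hP.degree_sub_C_coeff_mul_lt hf)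
  rwa [map_sub, ← smul_eq_C_mul, map_smul, sub_eq_zero] at h

theorem IsMonicSeq.eq_zero_of_triangular [NoZeroDivisors R] (hP : IsMonicSeq P)
    {φ : ℕ → R[X] →ₗ[R] R} (hφ : ∀ n, ∀ k < n, φ n (P k) = 0) (hne : ∀ n, φ n (P n) ≠ 0)
    {n : ℕ} {f : R[X]} (hf : f.degree < n) (h0 : ∀ k < n, φ k f = 0) : f = 0 := by
  by_contra hf0
  have hlt : f.natDegree < n := (natDegree_lt_iff_degree_lt hf0).2 hf
  have hlead : f.leadingCoeff * φ f.natDegree (P f.natDegree) = 0 :=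
    (hP.map_eq_coeff_smul (hφ _) degree_le_natDegree).symm.trans (h0 _ hlt)
  exact mul_ne_zero (leadingCoeff_ne_zero.2 hf0) (hne _) hlead

end MonicSequences

section OrthogonalSequences

variable {R : Type*} [CommRing R] [Nontrivial R] {L : R[X] →ₗ[R] R} {P Q : ℕ → R[X]}

/-- A sequence of monic orthogonal polynomials for the moment functional `L`. -/
structure IsMonicOrthogonalSeq (L : R[X] →ₗ[R] R) (P : ℕ → R[X]) : Prop where
  isMonicSeq : IsMonicSeq P
  map_mul_eq_zero : ∀ n, ∀ k < n, L (P n * P k) = 0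

namespace IsMonicOrthogonalSeq

theorem map_mul_eq_zero_of_degree_lt (hP : IsMonicOrthogonalSeq L P) {n : ℕ} {f : R[X]}
    (hf : f.degree < n) : L (P n * f) = 0 :=
  hP.isMonicSeq.map_eq_zero_of_degree_lt (φ := L ∘ₗ LinearMap.mulLeft R (P n))
    (hP.map_mul_eq_zero n) hf

theorem map_mul_eq_coeff_mul (hP : IsMonicOrthogonalSeq L P) {n : ℕ} {f : R[X]}
    (hf : f.degree ≤ n) : L (P n * f) = f.coeff n * L (P n * P n) :=
  hP.isMonicSeq.map_eq_coeff_smul (φ := L ∘ₗ LinearMap.mulLeft R (P n))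
    (hP.map_mul_eq_zero n) hf

theorem eq_zero_of_degree_lt [NoZeroDivisors R] (hP : IsMonicOrthogonalSeq L P)
    (hne : ∀ n, L (P n * P n) ≠ 0) {n : ℕ} {f : R[X]} (hf : f.degree < n)
    (h0 : ∀ k < n, L (P k * f) = 0) : f = 0 :=
  hP.isMonicSeq.eq_zero_of_triangular (φ := fun k => L ∘ₗ LinearMap.mulLeft R (P k))
    hP.map_mul_eq_zero hne hf h0

theorem unique [NoZeroDivisors R] (hP : IsMonicOrthogonalSeq L P)
    (hne : ∀ n, L (P n * P n) ≠ 0) (hQ : IsMonicOrthogonalSeq L Q) : Q = P := by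
  funext n
  refine sub_eq_zero.1 (hP.eq_zero_of_degree_lt hne (hQ.isMonicSeq.degree_sub_lt hP.isMonicSeq n)
    fun k hk => ?_)
  rw [mul_sub, map_sub, mul_comm, mul_comm (P k) (P n), hP.map_mul_eq_zero n k hk,
    hQ.map_mul_eq_zero_of_degree_lt (hP.isMonicSeq.degree_lt hk), sub_zero]

end IsMonicOrthogonalSeq

theorem isMonicSeq_of_eq_X_pow_sub_sum {c : ℕ → ℕ → R}
    (hP : ∀ n, P n = X ^ n - ∑ k : Fin n, C (c n k) * P k) : IsMonicSeq P := by
  refine isMonicSeq_X_pow.of_degree_sub_lt fun n => ?_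
  induction n using Nat.strong_induction_on with
  | _ n ih =>
    have hmem (k : Fin n) : P k ∈ degreeLT R n := by
      rw [← sub_add_cancel (P k) (X ^ (k : ℕ))]
      have hk : ((k : ℕ) : WithBot ℕ) < n := by exact_mod_cast k.2
      exact add_mem (mem_degreeLT.2 ((ih k k.2).trans hk))
        (mem_degreeLT.2 ((degree_X_pow _).trans_lt hk))
    rw [← mem_degreeLT, hP n, sub_sub_cancel_left]
    simp only [← smul_eq_C_mul]
    exact neg_mem (sum_mem fun k _ => Submodule.smul_mem _ _ (hmem k))

theorem isMonicOrthogonalSeq_of_gramSchmidt {K : Type*} [Field K] {L : K[X] →ₗ[K] K}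
    {P : ℕ → K[X]} (hne : ∀ k, L (P k * P k) ≠ 0)
    (hP : ∀ n, P n = X ^ n - ∑ k : Fin n, C (L (X ^ n * P k) / L (P k * P k)) * P k) :
    IsMonicOrthogonalSeq L P := by
  refine ⟨isMonicSeq_of_eq_X_pow_sub_sum
    (c := fun n k => L (X ^ n * P k) / L (P k * P k)) hP, fun n => ?_⟩
  induction n using Nat.strong_induction_on with
  | _ n ih =>
    intro k hk
    have horth (j : Fin n) (hj : j ≠ ⟨k, hk⟩) : L (P j * P k) = 0 := by
      rcases lt_or_gt_of_ne (Fin.val_ne_of_ne hj) with hlt | hlt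
      · rw [mul_comm]
        exact ih k hk j hlt
      · exact ih j j.2 k hlt
    rw [hP n, sub_mul, Finset.sum_mul, map_sub, map_sum, Finset.sum_eq_single ⟨k, hk⟩]
    · rw [mul_assoc, ← smul_eq_C_mul, map_smul, smul_eq_mul, div_mul_cancel₀ _ (hne k), sub_self]
    · intro j _ hj
      rw [mul_assoc, ← smul_eq_C_mul, map_smul, horth j hj, smul_zero]
    · exact fun h => absurd (Finset.mem_univ _) h

end OrthogonalSequences

section WronskianForm

variable {R A : Type*} [CommRing R] [CommRing A] [Algebra R A]

/-- The skew symmetric form `(f, g) ↦ L (f * D g) - L (g * D f)` attached to a functional `L` and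
an operator `D` on a commutative algebra. -/
def wronskianForm (L : A →ₗ[R] R) (D : A →ₗ[R] A) : LinearMap.BilinForm R A :=
  ((LinearMap.mul R A).compl₂ D - ((LinearMap.mul R A).compl₂ D).flip).compr₂ L

variable (L : A →ₗ[R] R) (D : A →ₗ[R] A)

theorem wronskianForm_apply (f g : A) : wronskianForm L D f g = L (f * D g) - L (g * D f) :=
  map_sub L _ _

theorem isAlt_wronskianForm : (wronskianForm L D).IsAlt := fun f => by
  rw [wronskianForm_apply, sub_self]

end WronskianForm

section SkewOrthogonality

variable {R V : Type*} [CommRing R] [AddCommGroup V] [Module R V] {S : LinearMap.BilinForm R V}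
  {v w : ℕ → V}

/-- A sequence is skew orthogonal if distinct pairs `(v (2 * n), v (2 * n + 1))` are orthogonal to
each other. For an alternating form the values `S (v (2 * n)) (v (2 * n + 1))` are then the only
undetermined entries of the Gram matrix. -/
def IsSkewOrthogonal (S : LinearMap.BilinForm R V) (v : ℕ → V) : Prop :=
  ∀ i j, i / 2 ≠ j / 2 → S (v i) (v j) = 0

theorem IsSkewOrthogonal.of_mem_span (hv : IsSkewOrthogonal S v)
    (hw : ∀ k, w k ∈ Submodule.span R {v (2 * (k / 2)), v (2 * (k / 2) + 1)}) :
    IsSkewOrthogonal S w := by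
  intro i j hij
  obtain ⟨a, b, hi⟩ := Submodule.mem_span_pair.1 (hw i)
  obtain ⟨c, d, hj⟩ := Submodule.mem_span_pair.1 (hw j)
  simp only [← hi, ← hj, map_add, map_smul, LinearMap.add_apply, LinearMap.smul_apply]
  rw [hv _ _ (by omega), hv _ _ (by omega), hv _ _ (by omega), hv _ _ (by omega)]
  simp

end SkewOrthogonality

section MonicSkewOrthogonalSequences

variable {R : Type*} [CommRing R] {S : LinearMap.BilinForm R R[X]} {Q T : ℕ → R[X]}

/-- A sequence of monic skew orthogonal polynomials for the bilinear form `S`. -/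
structure IsMonicSkewOrthogonalSeq (S : LinearMap.BilinForm R R[X]) (Q : ℕ → R[X]) : Prop where
  isMonicSeq : IsMonicSeq Q
  isSkewOrthogonal : IsSkewOrthogonal S Q

namespace IsMonicSkewOrthogonalSeq

variable [Nontrivial R]

theorem apply_eq_zero (hQ : IsMonicSkewOrthogonalSeq S Q) {k m : ℕ} (hk : k / 2 = m) {f : R[X]}
    (hf : f.degree < (2 * m : ℕ)) : S (Q k) f = 0 :=
  hQ.isMonicSeq.map_eq_zero_of_degree_lt (fun j hj => hQ.isSkewOrthogonal k j (by omega)) hf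

theorem eq_zero_of_degree_lt [NoZeroDivisors R] (hS : S.IsAlt)
    (hQ : IsMonicSkewOrthogonalSeq S Q) (hne : ∀ n, S (Q (2 * n)) (Q (2 * n + 1)) ≠ 0) {m : ℕ}
    {f : R[X]} (hf : f.degree < (2 * m : ℕ))
    (h0 : ∀ g : R[X], g.degree < (2 * m : ℕ) → S f g = 0) : f = 0 := by
  have hpartner (n : ℕ) : ∃ k, k / 2 = n / 2 ∧ S (Q k) (Q n) ≠ 0 := by
    obtain ⟨j, rfl | rfl⟩ := n.even_or_odd'
    · exact ⟨2 * j + 1, by omega, by rw [← hS.neg_eq]; exact neg_ne_zero.2 (hne j)⟩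
    · exact ⟨2 * j, by omega, hne j⟩
  choose k hk hkn using hpartner
  refine hQ.isMonicSeq.eq_zero_of_triangular (φ := fun n => S (Q (k n))) (fun n j hj => ?_) hkn hf
    fun n hn => hS.isRefl.eq_zero (h0 _ (hQ.isMonicSeq.degree_lt (by have := hk n; omega)))
  by_cases hjn : j / 2 = n / 2
  · have hkn' : k n ≠ n := fun h => hkn n (by rw [h, hS.self_eq_zero])
    have hkj : k n = j := by have := hk n; omega
    rw [hkj, hS.self_eq_zero]
  · exact hQ.isSkewOrthogonal _ _ (by rw [hk]; exact Ne.symm hjn)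

theorem iff_eq_and_exists_add_C_mul [NoZeroDivisors R] (hS : S.IsAlt)
    (hQ : IsMonicSkewOrthogonalSeq S Q) (hne : ∀ n, S (Q (2 * n)) (Q (2 * n + 1)) ≠ 0) :
    IsMonicSkewOrthogonalSeq S T ↔
      ∀ m, T (2 * m) = Q (2 * m) ∧ ∃ γ, T (2 * m + 1) = Q (2 * m + 1) + C γ * Q (2 * m) := by
  constructor
  · intro hT m
    constructor
    · refine sub_eq_zero.1 (hQ.eq_zero_of_degree_lt hS hne
        (hT.isMonicSeq.degree_sub_lt hQ.isMonicSeq (2 * m)) fun g hg => ?_)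
      rw [map_sub, LinearMap.sub_apply, hT.apply_eq_zero (by omega) hg,
        hQ.apply_eq_zero (by omega) hg, sub_zero]
    · let d := T (2 * m + 1) - Q (2 * m + 1)
      have hd : d.degree ≤ (2 * m : ℕ) :=
        Order.le_of_lt_succ (hT.isMonicSeq.degree_sub_lt hQ.isMonicSeq (2 * m + 1))
      refine ⟨d.coeff (2 * m), ?_⟩
      rw [← sub_eq_iff_eq_add', ← sub_eq_zero]
      refine hQ.eq_zero_of_degree_lt hS hne (hQ.isMonicSeq.degree_sub_C_coeff_mul_lt hd)
        fun g hg => ?_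
      simp only [d, ← smul_eq_C_mul, map_sub, map_smul, LinearMap.sub_apply, LinearMap.smul_apply]
      rw [hT.apply_eq_zero (by omega) hg, hQ.apply_eq_zero (by omega) hg,
        hQ.apply_eq_zero (by omega) hg]
      simp
  · intro hT
    choose heven γ hodd using hT
    refine ⟨hQ.isMonicSeq.of_degree_sub_lt fun n => ?_,
      hQ.isSkewOrthogonal.of_mem_span fun n => Submodule.mem_span_pair.2 ?_⟩
    · obtain ⟨m, rfl | rfl⟩ := n.even_or_odd'
      · rw [heven, sub_self, degree_zero]
        exact WithBot.bot_lt_coe _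
      · rw [hodd, add_sub_cancel_left, ← smul_eq_C_mul]
        exact (degree_smul_le _ _).trans_lt (hQ.isMonicSeq.degree_lt (Nat.lt_succ_self _))
    · obtain ⟨m, rfl | rfl⟩ := n.even_or_odd'
      · refine ⟨1, 0, ?_⟩
        rw [heven, one_smul, zero_smul, add_zero, Nat.mul_div_cancel_left m two_pos]
      · refine ⟨γ m, 1, ?_⟩
        rw [hodd, one_smul, smul_eq_C_mul, show (2 * m + 1) / 2 = m by omega, add_comm]

end IsMonicSkewOrthogonalSeq

end MonicSkewOrthogonalSequences

section SkewGramSchmidt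

variable {K V : Type*} [Field K] [AddCommGroup V] [Module K V] {S : LinearMap.BilinForm K V}
  {p : ℕ → V}

/-- The Gram matrix of `p`, for an alternating form `S`, is tridiagonal. -/
def IsTridiagonal (S : LinearMap.BilinForm K V) (p : ℕ → V) : Prop :=
  ∀ i j, i + 1 < j → S (p i) (p j) = 0

/-- The even-indexed part of the skew Gram-Schmidt process for a tridiagonal alternating form. -/
def skewEvenPart (S : LinearMap.BilinForm K V) (p : ℕ → V) : ℕ → V
  | 0 => p 0
  | m + 1 => p (2 * m + 2) +
      (S (p (2 * m + 1)) (p (2 * m + 2)) / S (p (2 * m)) (p (2 * m + 1))) • skewEvenPart S p m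

/-- The skew Gram-Schmidt process for a tridiagonal alternating form: the even-indexed vectors are
corrected by earlier even-indexed ones and the odd-indexed vectors are left unchanged. -/
def skewGramSchmidt (S : LinearMap.BilinForm K V) (p : ℕ → V) (n : ℕ) : V :=
  if Even n then skewEvenPart S p (n / 2) else p n

@[simp] theorem skewGramSchmidt_two_mul (m : ℕ) :
    skewGramSchmidt S p (2 * m) = skewEvenPart S p m := by
  simp [skewGramSchmidt]

@[simp] theorem skewGramSchmidt_two_mul_add_one (m : ℕ) :
    skewGramSchmidt S p (2 * m + 1) = p (2 * m + 1) := by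
  simp [skewGramSchmidt]

theorem map_skewEvenPart_eq_zero {M : Type*} [AddCommGroup M] [Module K M] {φ : V →ₗ[K] M}
    (hφ : ∀ j, φ (p (2 * j)) = 0) (m : ℕ) : φ (skewEvenPart S p m) = 0 := by
  induction m with
  | zero => exact hφ 0
  | succ m ih =>
    rw [skewEvenPart, map_add, map_smul, ih, smul_zero, add_zero]
    exact hφ (m + 1)

namespace IsTridiagonal

theorem apply_eq_zero (hp : IsTridiagonal S p) (hS : S.IsAlt) {i j : ℕ} (hij : i + 1 ≠ j)
    (hji : j + 1 ≠ i) : S (p i) (p j) = 0 := by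
  rcases lt_trichotomy i j with h | rfl | h
  · exact hp i j (by omega)
  · exact hS.self_eq_zero _
  · exact hS.isRefl.eq_zero (hp j i (by omega))

theorem skewEvenPart_apply_skewEvenPart (hp : IsTridiagonal S p) (hS : S.IsAlt) (m n : ℕ) :
    S (skewEvenPart S p m) (skewEvenPart S p n) = 0 :=
  map_skewEvenPart_eq_zero (φ := S (skewEvenPart S p m)) (fun j => hS.isRefl.eq_zero
    (map_skewEvenPart_eq_zero (φ := S (p (2 * j)))
      (fun _ => hp.apply_eq_zero hS (by omega) (by omega)) m)) n

theorem skewEvenPart_apply_odd (hp : IsTridiagonal S p) (hS : S.IsAlt)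
    (hne : ∀ n, S (p (2 * n)) (p (2 * n + 1)) ≠ 0) (n m : ℕ) :
    S (skewEvenPart S p n) (p (2 * m + 1)) =
      if n = m then S (p (2 * n)) (p (2 * n + 1)) else 0 := by
  have hfar {n : ℕ} (hnm : n ≠ m) (hnm' : n ≠ m + 1) : S (p (2 * n)) (p (2 * m + 1)) = 0 :=
    hp.apply_eq_zero hS (by omega) (by omega)
  induction n with
  | zero =>
    split_ifs with h
    · rw [skewEvenPart, ← h]
    · exact hfar h (by omega)
  | succ n ih =>
    rw [skewEvenPart, map_add, map_smul, LinearMap.add_apply, LinearMap.smul_apply, ih, smul_eq_mul]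
    rcases eq_or_ne n m with rfl | hnm
    · rw [if_pos rfl, if_neg n.succ_ne_self, div_mul_cancel₀ _ (hne n),
        ← hS.neg_eq (p (2 * n + 1)), neg_add_cancel]
    · rw [if_neg hnm, mul_zero, add_zero]
      split_ifs with h
      · rw [← h, Nat.mul_succ]
      · exact hfar h (by omega)

theorem isSkewOrthogonal_skewGramSchmidt (hp : IsTridiagonal S p) (hS : S.IsAlt)
    (hne : ∀ n, S (p (2 * n)) (p (2 * n + 1)) ≠ 0) :
    IsSkewOrthogonal S (skewGramSchmidt S p) := by
  intro i j hij
  obtain ⟨m, rfl | rfl⟩ := i.even_or_odd' <;> obtain ⟨n, rfl | rfl⟩ := j.even_or_odd' <;>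
    simp only [skewGramSchmidt_two_mul, skewGramSchmidt_two_mul_add_one]
  · exact hp.skewEvenPart_apply_skewEvenPart hS m n
  · rw [hp.skewEvenPart_apply_odd hS hne, if_neg (by omega)]
  · rw [← hS.neg_eq, hp.skewEvenPart_apply_odd hS hne, if_neg (by omega), neg_zero]
  · exact hp.apply_eq_zero hS (by omega) (by omega)

theorem skewGramSchmidt_apply_succ (hp : IsTridiagonal S p) (hS : S.IsAlt)
    (hne : ∀ n, S (p (2 * n)) (p (2 * n + 1)) ≠ 0) (n : ℕ) :
    S (skewGramSchmidt S p (2 * n)) (skewGramSchmidt S p (2 * n + 1)) =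
      S (p (2 * n)) (p (2 * n + 1)) := by
  rw [skewGramSchmidt_two_mul, skewGramSchmidt_two_mul_add_one, hp.skewEvenPart_apply_odd hS hne,
    if_pos rfl]

end IsTridiagonal

theorem IsMonicSeq.skewGramSchmidt {S : LinearMap.BilinForm K K[X]} {P : ℕ → K[X]}
    (hP : IsMonicSeq P) : IsMonicSeq (skewGramSchmidt S P) := by
  have hmem (m : ℕ) : skewEvenPart S P m ∈ degreeLT K (2 * m + 1) := by
    induction m with
    | zero => exact mem_degreeLT.2 (hP.degree_lt one_pos)
    | succ m ih =>
      exact add_mem (mem_degreeLT.2 (hP.degree_lt (Nat.lt_succ_self _)))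
        (Submodule.smul_mem _ _ (degreeLT_mono (by omega) ih))
  refine hP.of_degree_sub_lt fun n => ?_
  obtain ⟨m, rfl | rfl⟩ := n.even_or_odd'
  · rw [skewGramSchmidt_two_mul, ← mem_degreeLT]
    cases m with
    | zero => rw [skewEvenPart, sub_self]; exact zero_mem _
    | succ m =>
      rw [skewEvenPart, Nat.mul_succ, add_sub_cancel_left]
      exact Submodule.smul_mem _ _ (degreeLT_mono (by omega) (hmem m))
  · rw [skewGramSchmidt_two_mul_add_one, sub_self, degree_zero]
    exact WithBot.bot_lt_coe _

end SkewGramSchmidt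

section QDifference

variable (q : ℝ) {f : ℝ[X]} {n : ℕ}

/-- The `q`-difference operator `D_q` as a linear operator on polynomials. -/
def qDiffPoly : ℝ[X] →ₗ[ℝ] ℝ[X] where
  toFun f := C (1 - q)⁻¹ * (f - f.comp (C q * X)).divX
  map_add' f g := by
    ext n
    simp only [coeff_C_mul, coeff_divX, coeff_sub, coeff_add, add_comp]
    ring
  map_smul' c f := by
    ext n
    simp only [coeff_C_mul, coeff_divX, coeff_sub, coeff_smul, smul_comp, smul_eq_mul,
      RingHom.id_apply]
    ring

theorem coeff_qDiffPoly (f : ℝ[X]) (n : ℕ) :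
    (qDiffPoly q f).coeff n = qNumber q (n + 1) * f.coeff (n + 1) := by
  simp only [qDiffPoly, LinearMap.coe_mk, AddHom.coe_mk, coeff_C_mul, coeff_divX, coeff_sub,
    comp_C_mul_X_coeff, qNumber]
  ring

theorem coeff_X_mul_qDiffPoly (f : ℝ[X]) (n : ℕ) :
    (X * qDiffPoly q f).coeff n = qNumber q n * f.coeff n := by
  cases n with
  | zero => simp [qNumber]
  | succ n => rw [coeff_X_mul, coeff_qDiffPoly]

theorem eval_qDiffPoly (f : ℝ[X]) {x : ℝ} (hx : x ≠ 0) :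
    (qDiffPoly q f).eval x = qDiff q (fun y => f.eval y) x := by
  have hdivX := congrArg (eval x) (divX_mul_X_add (f - f.comp (C q * X)))
  simp only [coeff_sub, comp_C_mul_X_coeff, pow_zero, mul_one, sub_self, eval_mul, eval_X,
    eval_sub, eval_comp, eval_C, map_zero, add_zero] at hdivX
  simp only [qDiffPoly, LinearMap.coe_mk, AddHom.coe_mk, eval_mul, eval_C, qDiff]
  rw [← hdivX]
  field_simp

theorem degree_qDiffPoly_lt (hf : f.degree < (n + 1 : ℕ)) : (qDiffPoly q f).degree < n := by
  rw [degree_lt_iff_coeff_zero] at hf ⊢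
  intro k hk
  rw [coeff_qDiffPoly, hf (k + 1) (by omega), mul_zero]

theorem degree_X_mul_qDiffPoly_le (f : ℝ[X]) : (X * qDiffPoly q f).degree ≤ f.degree :=
  (degree_le_iff_coeff_zero _ _).2 fun k hk => by
    rw [coeff_X_mul_qDiffPoly, coeff_eq_zero_of_degree_lt hk, mul_zero]

theorem degree_comp_C_mul_X_le (f : ℝ[X]) : (f.comp (C q * X)).degree ≤ f.degree :=
  (degree_le_iff_coeff_zero _ _).2 fun k hk => by
    rw [comp_C_mul_X_coeff, coeff_eq_zero_of_degree_lt hk, zero_mul]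

end QDifference

section JacksonWeights

/-- A weight that is positive and has finite mass on the lattice `{q ^ n}` of the Jackson
integral. -/
structure IsJacksonWeight (q : ℝ) (ω : ℝ → ℝ) : Prop where
  q_pos : 0 < q
  q_lt_one : q < 1
  pos : ∀ n : ℕ, 0 < ω (q ^ n)
  summable : Summable fun n : ℕ => q ^ n * ω (q ^ n)

namespace IsJacksonWeight

variable {q : ℝ} {ω : ℝ → ℝ}

theorem summable_eval (h : IsJacksonWeight q ω) (f : ℝ[X]) :
    Summable fun n : ℕ => q ^ n * (f.eval (q ^ n) * ω (q ^ n)) := by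
  obtain ⟨M, hM⟩ := (isCompact_Icc (a := (0 : ℝ)) (b := 1)).exists_bound_of_continuousOn
    f.continuousOn
  refine Summable.of_norm_bounded (h.summable.norm.mul_left M) fun n => ?_
  rw [mul_left_comm, norm_mul]
  gcongr
  exact hM _ ⟨pow_nonneg h.q_pos.le n, pow_le_one₀ h.q_pos.le h.q_lt_one.le⟩

/-- The moment functional `f ↦ ∫_0^1 f(x) ω(x) d_q x` on polynomials. -/
def functional (h : IsJacksonWeight q ω) : ℝ[X] →ₗ[ℝ] ℝ where
  toFun f := jackson q fun x => f.eval x * ω x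
  map_add' f g := by
    simp only [jackson]
    rw [← mul_add, ← (h.summable_eval f).tsum_add (h.summable_eval g)]
    simp only [eval_add, add_mul, mul_add]
  map_smul' c f := by
    simp only [jackson]
    rw [RingHom.id_apply, smul_eq_mul, mul_left_comm, ← tsum_mul_left (a := c)]
    simp only [eval_smul, smul_eq_mul, mul_assoc, mul_left_comm c]

theorem functional_apply (h : IsJacksonWeight q ω) (f : ℝ[X]) :
    h.functional f = jackson q fun x => f.eval x * ω x := rfl

theorem hasSum_functional (h : IsJacksonWeight q ω) (f : ℝ[X]) :
    HasSum (fun n : ℕ => (1 - q) * (q ^ n * (f.eval (q ^ n) * ω (q ^ n)))) (h.functional f) :=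
  (h.summable_eval f).hasSum.mul_left (1 - q)

theorem hasSum_functional_succ (h : IsJacksonWeight q ω) {f : ℝ[X]} (hf : f.eval 1 = 0) :
    HasSum (fun n : ℕ => (1 - q) * (q ^ (n + 1) * (f.eval (q ^ (n + 1)) * ω (q ^ (n + 1)))))
      (h.functional f) := by
  simpa [hf] using (hasSum_nat_add_iff' 1).2 (h.hasSum_functional f)

/-- The skew symmetric form `⟨f, g⟩_s` of the weight as a bilinear form on polynomials. -/
abbrev skewBilinForm (h : IsJacksonWeight q ω) : LinearMap.BilinForm ℝ ℝ[X] :=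
  wronskianForm h.functional (qDiffPoly q)

theorem symmForm_eq (h : IsJacksonWeight q ω) (f g : ℝ[X]) :
    symmForm q ω f g = h.functional (f * g) := by
  simp only [symmForm, functional_apply, eval_mul]

theorem skewForm_eq (h : IsJacksonWeight q ω) (f g : ℝ[X]) :
    skewForm q ω f g = h.skewBilinForm f g := by
  rw [wronskianForm_apply, ← map_sub, functional_apply, skewForm, jackson, jackson]
  simp only [eval_sub, eval_mul, eval_qDiffPoly q _ (pow_ne_zero _ h.q_pos.ne')]

theorem functional_mul_self_pos (h : IsJacksonWeight q ω) {f : ℝ[X]} (hf : f ≠ 0) :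
    0 < h.functional (f * f) := by
  have hinj : Function.Injective fun n : ℕ => q ^ n :=
    (pow_right_strictAnti₀ h.q_pos h.q_lt_one).injective
  obtain ⟨n, hn⟩ : ∃ n : ℕ, f.eval (q ^ n) ≠ 0 := by
    by_contra! hroots
    exact hf (f.eq_zero_of_infinite_isRoot
      ((Set.infinite_range_of_injective hinj).mono (Set.range_subset_iff.2 hroots)))
  refine mul_pos (sub_pos.2 h.q_lt_one) ((h.summable_eval _).tsum_pos (fun k => ?_) n ?_)
  · rw [eval_mul]
    exact mul_nonneg (pow_pos h.q_pos k).le (mul_nonneg (mul_self_nonneg _) (h.pos k).le)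
  · rw [eval_mul]
    exact mul_pos (pow_pos h.q_pos n) (mul_pos (mul_self_pos.2 hn) (h.pos n))

theorem isMonicOrthogonal_iff (h : IsJacksonWeight q ω) {p : ℕ → ℝ[X]} :
    IsMonicOrthogonal q ω p ↔ IsMonicOrthogonalSeq h.functional p := by
  simp only [IsMonicOrthogonal, h.symmForm_eq]
  constructor
  · intro hp
    have hmonic : IsMonicSeq p := fun n => ⟨(hp n).1, (hp n).2.1⟩
    exact ⟨hmonic, fun n k hk => isMonicSeq_X_pow.map_eq_zero_of_degree_lt
      (φ := h.functional ∘ₗ LinearMap.mulLeft ℝ (p n)) (hp n).2.2 (hmonic.degree_lt hk)⟩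
  · exact fun hp n => ⟨(hp.isMonicSeq n).1, (hp.isMonicSeq n).2, fun k hk =>
      hp.map_mul_eq_zero_of_degree_lt (isMonicSeq_X_pow.degree_lt hk)⟩

theorem isMonicSkewOrthogonal_iff (h : IsJacksonWeight q ω) {Q : ℕ → ℝ[X]} {u : ℕ → ℝ} :
    IsMonicSkewOrthogonal q ω Q u ↔
      IsMonicSkewOrthogonalSeq h.skewBilinForm Q ∧
        ∀ n, h.skewBilinForm (Q (2 * n)) (Q (2 * n + 1)) = u n := by
  have hS := isAlt_wronskianForm h.functional (qDiffPoly q)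
  simp only [IsMonicSkewOrthogonal, h.skewForm_eq]
  constructor
  · rintro ⟨hmonic, hQ⟩
    refine ⟨⟨hmonic, fun i j hij => ?_⟩, fun n => by simpa using (hQ n n).1⟩
    obtain ⟨m, rfl | rfl⟩ := i.even_or_odd' <;> obtain ⟨n, rfl | rfl⟩ := j.even_or_odd'
    · exact (hQ m n).2.2.1
    · exact (hQ n m).1.trans (if_neg (by omega))
    · rw [(hQ m n).2.1, if_neg (by omega), neg_zero]
    · exact (hQ m n).2.2.2
  · rintro ⟨⟨hmonic, hQ⟩, hu⟩
    have heven_odd (n m : ℕ) : h.skewBilinForm (Q (2 * n))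
        (Q (2 * m + 1)) = if n = m then u n else 0 := by
      split_ifs with hnm
      · rw [← hnm, hu]
      · exact hQ _ _ (by omega)
    refine ⟨hmonic, fun m n => ⟨heven_odd n m, ?_, ?_, ?_⟩⟩
    · rw [← hS.neg_eq, heven_odd]
    all_goals
      rcases eq_or_ne m n with rfl | hmn
      · exact hS.self_eq_zero _
      · exact hQ _ _ (by omega)

end IsJacksonWeight

end JacksonWeights

section PearsonPairs

/-- The discrete Pearson equation linking a weight `ω` and the weight `ω₁` of the derivatives of its
orthogonal polynomials: on the lattice `{q ^ n}`, `ω₁(x) = x σ(x) ω(x) = q x τ(q x) ω(q x)` with `σ`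
and `τ` of degree at most `1`, and `τ` vanishes at the right end point. -/
structure IsPearsonPair (q : ℝ) (ω ω₁ : ℝ → ℝ) (σ τ : ℝ[X]) : Prop where
  natDegree_left : σ.natDegree ≤ 1
  natDegree_right : τ.natDegree ≤ 1
  eq_left : ∀ n : ℕ, ω₁ (q ^ n) = q ^ n * σ.eval (q ^ n) * ω (q ^ n)
  eq_right : ∀ n : ℕ, ω₁ (q ^ n) = q ^ (n + 1) * τ.eval (q ^ (n + 1)) * ω (q ^ (n + 1))
  eval_one : τ.eval 1 = 0

/-- The adjoint of `D_q` relative to a Pearson pair, see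
`IsPearsonPair.functional_mul_qDiffPoly`. -/
def qDiffAdjoint (q : ℝ) (σ τ f : ℝ[X]) : ℝ[X] :=
  C (1 - q)⁻¹ * (σ * f - τ * f.comp (C q⁻¹ * X))

theorem degree_mul_lt_of_natDegree_le {R : Type*} [Semiring R] {f g : R[X]} {m n : ℕ}
    (hf : f.natDegree ≤ m) (hg : g.degree < n) : (f * g).degree < (m + n : ℕ) :=
  calc (f * g).degree ≤ f.degree + g.degree := degree_mul_le f g
    _ ≤ m + g.degree := by gcongr; exact natDegree_le_iff_degree_le.1 hf
    _ < m + n := WithBot.add_lt_add_left (WithBot.coe_ne_bot) hg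

namespace IsPearsonPair

variable {q : ℝ} {ω ω₁ : ℝ → ℝ} {σ τ f : ℝ[X]} {p P : ℕ → ℝ[X]} {n : ℕ}
  {h : IsJacksonWeight q ω} {h₁ : IsJacksonWeight q ω₁}

theorem functional_eq (hpair : IsPearsonPair q ω ω₁ σ τ) (f : ℝ[X]) :
    h₁.functional f = h.functional (σ * (X * f)) := by
  simp only [IsJacksonWeight.functional_apply, jackson, hpair.eq_left, eval_mul, eval_X]
  congr! 3 with n
  ring

theorem degree_qDiffAdjoint_lt (hpair : IsPearsonPair q ω ω₁ σ τ) (hf : f.degree < n) :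
    (qDiffAdjoint q σ τ f).degree < (n + 1 : ℕ) := by
  rw [qDiffAdjoint, ← smul_eq_C_mul, add_comm]
  exact ((degree_smul_le _ _).trans (degree_sub_le _ _)).trans_lt
    (max_lt (degree_mul_lt_of_natDegree_le hpair.natDegree_left hf)
      (degree_mul_lt_of_natDegree_le hpair.natDegree_right
        ((degree_comp_C_mul_X_le _ _).trans_lt hf)))

theorem functional_mul_qDiffPoly (hpair : IsPearsonPair q ω ω₁ σ τ) (f g : ℝ[X]) :
    h₁.functional (f * qDiffPoly q g) = h.functional (g * qDiffAdjoint q σ τ f) := by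
  have hright : (C (1 - q)⁻¹ * (τ * f.comp (C q⁻¹ * X) * g)).eval 1 = 0 := by
    simp [hpair.eval_one]
  have hsum := (h.hasSum_functional (C (1 - q)⁻¹ * (σ * f * g))).sub
    (h.hasSum_functional_succ hright)
  rw [← map_sub] at hsum
  rw [show g * qDiffAdjoint q σ τ f = C (1 - q)⁻¹ * (σ * f * g) -
    C (1 - q)⁻¹ * (τ * f.comp (C q⁻¹ * X) * g) by rw [qDiffAdjoint]; ring]
  refine (h₁.hasSum_functional _).unique (hsum.congr_fun fun n => ?_)
  have hq : 1 - q ≠ 0 := (sub_pos.2 h.q_lt_one).ne'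
  have hx : q ^ n ≠ 0 := pow_ne_zero n h.q_pos.ne'
  have hback : q⁻¹ * q ^ (n + 1) = q ^ n := by rw [pow_succ', inv_mul_cancel_left₀ h.q_pos.ne']
  simp only [eval_mul, eval_C, eval_comp, eval_X, eval_qDiffPoly q g hx, qDiff, hback, ← pow_succ']
  field_simp
  linear_combination f.eval (q ^ n) * g.eval (q ^ n) * hpair.eq_left n -
    f.eval (q ^ n) * g.eval (q ^ (n + 1)) * hpair.eq_right n

theorem functional_mul_qDiffPoly_succ_eq_zero (hpair : IsPearsonPair q ω ω₁ σ τ)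
    (hp : IsMonicOrthogonalSeq h.functional p) (hf : f.degree < n) :
    h₁.functional (f * qDiffPoly q (p (n + 1))) = 0 := by
  rw [hpair.functional_mul_qDiffPoly (h := h)]
  exact hp.map_mul_eq_zero_of_degree_lt (hpair.degree_qDiffAdjoint_lt hf)

theorem functional_succ_mul_qDiffPoly_eq_zero (hpair : IsPearsonPair q ω ω₁ σ τ)
    (hp : IsMonicOrthogonalSeq h.functional p) (hf : f.degree < n) :
    h₁.functional (p (n + 1) * qDiffPoly q f) = 0 := by
  rw [hpair.functional_eq (h := h), mul_left_comm X, mul_left_comm σ]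
  refine hp.map_mul_eq_zero_of_degree_lt ?_
  rw [add_comm]
  exact degree_mul_lt_of_natDegree_le hpair.natDegree_left
    ((degree_X_mul_qDiffPoly_le q f).trans_lt hf)

theorem isTridiagonal (hpair : IsPearsonPair q ω ω₁ σ τ)
    (hp : IsMonicOrthogonalSeq h.functional p) :
    IsTridiagonal h₁.skewBilinForm p := by
  intro i j hij
  obtain ⟨n, rfl⟩ : ∃ n, j = n + 1 := ⟨j - 1, by omega⟩
  have hi : (p i).degree < n := hp.isMonicSeq.degree_lt (by omega)
  rw [wronskianForm_apply, hpair.functional_mul_qDiffPoly_succ_eq_zero hp hi,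
    hpair.functional_succ_mul_qDiffPoly_eq_zero hp hi, sub_zero]

theorem qDiffPoly_succ (hpair : IsPearsonPair q ω ω₁ σ τ)
    (hp : IsMonicOrthogonalSeq h.functional p) (hP : IsMonicOrthogonalSeq h₁.functional P) (n : ℕ) :
    qDiffPoly q (p (n + 1)) = C (qNumber q (n + 1)) * P n := by
  have hdeg : (qDiffPoly q (p (n + 1))).degree ≤ n :=
    Order.le_of_lt_succ (degree_qDiffPoly_lt q (hp.isMonicSeq.degree_lt (n + 1).lt_succ_self))
  have hcoeff : (qDiffPoly q (p (n + 1))).coeff n = qNumber q (n + 1) := by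
    rw [coeff_qDiffPoly, hp.isMonicSeq.coeff_self, mul_one]
  rw [← hcoeff, ← sub_eq_zero]
  refine hP.eq_zero_of_degree_lt
    (fun k => (h₁.functional_mul_self_pos (hP.isMonicSeq k).1.ne_zero).ne')
    (hP.isMonicSeq.degree_sub_C_coeff_mul_lt hdeg) fun k hk => ?_
  have hPk : (P k).degree < n := hP.isMonicSeq.degree_lt hk
  rw [mul_sub, map_sub, hpair.functional_mul_qDiffPoly_succ_eq_zero hp hPk, ← smul_eq_C_mul,
    mul_smul_comm, map_smul, mul_comm, hP.map_mul_eq_zero n k hk, smul_zero, sub_zero]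

theorem functional_succ_mul_qDiffPoly_self (hpair : IsPearsonPair q ω ω₁ σ τ)
    (hp : IsMonicOrthogonalSeq h.functional p) (n : ℕ) :
    h₁.functional (p (n + 1) * qDiffPoly q (p n)) =
      σ.coeff 1 * qNumber q n * h.functional (p (n + 1) * p (n + 1)) := by
  have hdeg : (X * qDiffPoly q (p n)).natDegree ≤ n := natDegree_le_of_degree_le
    ((degree_X_mul_qDiffPoly_le q (p n)).trans_eq (hp.isMonicSeq.degree_eq n))
  have hcoeff : (σ * (X * qDiffPoly q (p n))).coeff (n + 1) = σ.coeff 1 * qNumber q n := by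
    rw [add_comm n, coeff_mul_add_eq_of_natDegree_le hpair.natDegree_left hdeg,
      coeff_X_mul_qDiffPoly, hp.isMonicSeq.coeff_self, mul_one]
  rw [hpair.functional_eq (h := h), mul_left_comm X, mul_left_comm σ, ← hcoeff]
  refine hp.map_mul_eq_coeff_mul (degree_le_of_natDegree_le ?_)
  rw [add_comm]
  exact natDegree_mul_le_of_le hpair.natDegree_left hdeg

theorem skewBilinForm_succ (hpair : IsPearsonPair q ω ω₁ σ τ)
    (hp : IsMonicOrthogonalSeq h.functional p) (hP : IsMonicOrthogonalSeq h₁.functional P) (n : ℕ) :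
    h₁.skewBilinForm (p n) (p (n + 1)) =
      qNumber q (n + 1) * h₁.functional (P n * P n) -
        σ.coeff 1 * qNumber q n * h.functional (p (n + 1) * p (n + 1)) := by
  rw [wronskianForm_apply, hpair.functional_succ_mul_qDiffPoly_self hp, hpair.qDiffPoly_succ hp hP,
    ← smul_eq_C_mul, mul_smul_comm, map_smul, smul_eq_mul, mul_comm (p n),
    hP.map_mul_eq_coeff_mul (hp.isMonicSeq.degree_eq n).le, hp.isMonicSeq.coeff_self, one_mul]

end IsPearsonPair

end PearsonPairs

section Weights

variable {q a α β : ℝ}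

theorem summable_neg_mul_pow (hq0 : 0 < q) (hq1 : q < 1) (a : ℝ) :
    Summable fun i : ℕ => -(a * q ^ i) :=
  ((summable_geometric_of_lt_one hq0.le hq1).mul_left a).neg

theorem qPochInf_eq_mul (hq0 : 0 < q) (hq1 : q < 1) (a : ℝ) :
    qPochInf a q = (1 - a) * qPochInf (a * q) q := by
  have hshift : (fun i : ℕ => 1 - a * q ^ (i + 1)) = fun i : ℕ => 1 - a * q * q ^ i :=
    funext fun i => by ring
  have hmul : Multipliable fun i : ℕ => 1 - a * q ^ (i + 1) := by
    simpa only [hshift, ← sub_eq_add_neg] using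
      Real.multipliable_one_add_of_summable (summable_neg_mul_pow hq0 hq1 (a * q))
  rw [qPochInf, qPochInf, tprod_eq_zero_mul' (f := fun i : ℕ => 1 - a * q ^ i) hmul, hshift,
    pow_zero, mul_one]

theorem qPochInf_pos (hq0 : 0 < q) (hq1 : q < 1) (ha : a < 1) : 0 < qPochInf a q := by
  have hpos (i : ℕ) : 0 < 1 + -(a * q ^ i) := by
    have hle : q ^ i ≤ 1 := pow_le_one₀ hq0.le hq1.le
    have hlt : 0 < q ^ i := pow_pos hq0 i
    rcases le_or_gt a 0 with ha0 | ha0 <;> nlinarith [ha0]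
  simp only [qPochInf, sub_eq_add_neg]
  rw [← Real.rexp_tsum_eq_tprod hpos
    (Real.summable_log_one_add_of_summable (summable_neg_mul_pow hq0 hq1 a))]
  exact Real.exp_pos _

theorem rpow_mul_pow_lt_one (hq0 : 0 < q) (hq1 : q < 1) (hβ : -1 < β) (n : ℕ) :
    q ^ (β + 1) * q ^ n < 1 :=
  (mul_le_of_le_one_right (Real.rpow_nonneg hq0.le _) (pow_le_one₀ hq0.le hq1.le)).trans_lt
    (Real.rpow_lt_one hq0.le hq1 (by linarith))

theorem weight_pow (hq0 : 0 < q) (α β : ℝ) (n : ℕ) :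
    weight q α β (q ^ n) =
      qPochInf (q ^ (n + 1)) q / qPochInf (q ^ (β + 1) * q ^ n) q * (q ^ α) ^ n := by
  have hden : q * q ^ n * q ^ β = q ^ (β + 1) * q ^ n := by
    rw [Real.rpow_add_one hq0.ne']
    ring
  rw [weight, qPoch, hden, ← Real.rpow_pow_comm hq0.le, pow_succ']

theorem weight_pow_pos (hq0 : 0 < q) (hq1 : q < 1) (α : ℝ) (hβ : -1 < β) (n : ℕ) :
    0 < weight q α β (q ^ n) := by
  rw [weight_pow hq0]
  exact mul_pos
    (div_pos (qPochInf_pos hq0 hq1 (pow_lt_one₀ hq0.le hq1 n.succ_ne_zero))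
      (qPochInf_pos hq0 hq1 (rpow_mul_pow_lt_one hq0 hq1 hβ n)))
    (pow_pos (Real.rpow_pos_of_pos hq0 _) _)

theorem one_sub_mul_weight_pow_succ (hq0 : 0 < q) (hq1 : q < 1) (α : ℝ) (hβ : -1 < β) (n : ℕ) :
    (1 - q ^ (n + 1)) * weight q α β (q ^ (n + 1)) =
      q ^ α * (1 - q ^ (β + 1) * q ^ n) * weight q α β (q ^ n) := by
  have hfactor : 1 - q ^ (β + 1) * q ^ n ≠ 0 :=
    (sub_pos.2 (rpow_mul_pow_lt_one hq0 hq1 hβ n)).ne'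
  rw [weight_pow hq0, weight_pow hq0, qPochInf_eq_mul hq0 hq1 (q ^ (n + 1)),
    qPochInf_eq_mul hq0 hq1 (q ^ (β + 1) * q ^ n), mul_assoc _ _ q, ← pow_succ, ← pow_succ,
    pow_succ (q ^ α)]
  field_simp

theorem weight_add_one_pow (hq0 : 0 < q) (hq1 : q < 1) (α : ℝ) (hβ : -1 < β) (n : ℕ) :
    weight q (α + 1) (β + 1) (q ^ n) =
      q ^ n * (1 - q ^ (β + 1) * q ^ n) * weight q α β (q ^ n) := by
  have hfactor : 1 - q ^ (β + 1) * q ^ n ≠ 0 :=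
    (sub_pos.2 (rpow_mul_pow_lt_one hq0 hq1 hβ n)).ne'
  rw [weight_pow hq0, weight_pow hq0, qPochInf_eq_mul hq0 hq1 (q ^ (β + 1) * q ^ n),
    Real.rpow_add_one hq0.ne' (β + 1), Real.rpow_add_one hq0.ne' α, mul_pow,
    mul_assoc _ q, mul_assoc _ _ q, ← pow_succ, ← pow_succ']
  field_simp

theorem summable_pow_mul_weight (hq0 : 0 < q) (hq1 : q < 1) (hα : -1 < α) (hβ : -1 < β) :
    Summable fun n : ℕ => q ^ n * weight q α β (q ^ n) := by
  have hpos (n : ℕ) : 0 < q ^ n * weight q α β (q ^ n) :=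
    mul_pos (pow_pos hq0 n) (weight_pow_pos hq0 hq1 α hβ n)
  refine summable_of_ratio_test_tendsto_lt_one (Real.rpow_lt_one hq0.le hq1 (by linarith))
    (.of_forall fun n => (hpos n).ne') (l := q ^ (α + 1)) ?_
  have hq : Filter.Tendsto (fun n : ℕ => q ^ n) Filter.atTop (nhds 0) :=
    tendsto_pow_atTop_nhds_zero_of_lt_one hq0.le hq1
  have hlim : Filter.Tendsto
      (fun n : ℕ => q ^ (α + 1) * (1 - q ^ (β + 1) * q ^ n) / (1 - q ^ (n + 1)))
      Filter.atTop (nhds (q ^ (α + 1) * (1 - q ^ (β + 1) * 0) / (1 - 0))) :=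
    (((hq.const_mul _).const_sub 1).const_mul _).div
      (((Filter.tendsto_add_atTop_iff_nat 1).2 hq).const_sub 1) (by norm_num)
  simp only [mul_zero, sub_zero, mul_one, div_one] at hlim
  refine hlim.congr fun n => ?_
  have hne : 1 - q ^ (n + 1) ≠ 0 := (sub_pos.2 (pow_lt_one₀ hq0.le hq1 n.succ_ne_zero)).ne'
  rw [Real.norm_of_nonneg (hpos _).le, Real.norm_of_nonneg (hpos _).le,
    div_eq_div_iff hne (hpos n).ne', Real.rpow_add_one hq0.ne']
  linear_combination (-q ^ (n + 1)) * one_sub_mul_weight_pow_succ hq0 hq1 α hβ n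

theorem isJacksonWeight_weight (hq0 : 0 < q) (hq1 : q < 1) (hα : -1 < α) (hβ : -1 < β) :
    IsJacksonWeight q (weight q α β) :=
  ⟨hq0, hq1, weight_pow_pos hq0 hq1 α hβ, summable_pow_mul_weight hq0 hq1 hα hβ⟩

theorem isPearsonPair_weight (hq0 : 0 < q) (hq1 : q < 1) (α : ℝ) (hβ : -1 < β) :
    IsPearsonPair q (weight q α β) (weight q (α + 1) (β + 1)) (1 - C (q ^ (β + 1)) * X)
      (C (q ^ (α + 1))⁻¹ * (1 - X)) where
  natDegree_left := by compute_degree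
  natDegree_right := by compute_degree
  eq_left n := by simpa using weight_add_one_pow hq0 hq1 α hβ n
  eq_right n := by
    have hα : q ^ α ≠ 0 := (Real.rpow_pos_of_pos hq0 α).ne'
    simp only [weight_add_one_pow hq0 hq1 α hβ n, eval_mul, eval_C, eval_sub, eval_one, eval_X,
      mul_assoc, one_sub_mul_weight_pow_succ hq0 hq1 α hβ n, Real.rpow_add_one hq0.ne' α]
    field_simp
    ring
  eval_one := by simp

end Weights

section LittleQJacobiPolynomials

variable {q α β : ℝ}

theorem isMonicSeq_poly (q α β : ℝ) : IsMonicSeq (poly q α β) :=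
  isMonicSeq_of_eq_X_pow_sub_sum
    (c := fun n k => symmForm q (weight q α β) (X ^ n) (poly q α β k) /
      symmForm q (weight q α β) (poly q α β k) (poly q α β k)) fun n => by rw [poly]

theorem isMonicOrthogonalSeq_poly (h : IsJacksonWeight q (weight q α β)) :
    IsMonicOrthogonalSeq h.functional (poly q α β) :=
  isMonicOrthogonalSeq_of_gramSchmidt
    (fun k => (h.functional_mul_self_pos (isMonicSeq_poly q α β k).1.ne_zero).ne')
    fun n => by simp only [← h.symmForm_eq]; rw [poly]

theorem norm_eq (h : IsJacksonWeight q (weight q α β)) (n : ℕ) :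
    norm q α β n = h.functional (poly q α β n * poly q α β n) :=
  h.symmForm_eq _ _

theorem norm_pos (h : IsJacksonWeight q (weight q α β)) (n : ℕ) : 0 < norm q α β n := by
  rw [norm_eq h]
  exact h.functional_mul_self_pos (isMonicSeq_poly q α β n).1.ne_zero

theorem isMonicOrthogonal_iff_eq_poly (h : IsJacksonWeight q (weight q α β)) {p : ℕ → ℝ[X]} :
    IsMonicOrthogonal q (weight q α β) p ↔ p = poly q α β := by
  have hpoly := isMonicOrthogonalSeq_poly h
  rw [h.isMonicOrthogonal_iff]
  refine ⟨hpoly.unique fun n => ?_, fun hp => hp ▸ hpoly⟩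
  rw [← norm_eq]
  exact (norm_pos h n).ne'

theorem skewBilinForm_poly_succ (h : IsJacksonWeight q (weight q α β))
    (h₁ : IsJacksonWeight q (weight q (α + 1) (β + 1))) (hβ : -1 < β) (n : ℕ) :
    h₁.skewBilinForm (poly q α β n) (poly q α β (n + 1)) =
      qNumber q (n + 1) * norm q (α + 1) (β + 1) n +
        q ^ (β + 1) * qNumber q n * norm q α β (n + 1) := by
  rw [(isPearsonPair_weight h.q_pos h.q_lt_one α hβ).skewBilinForm_succ
    (isMonicOrthogonalSeq_poly h) (isMonicOrthogonalSeq_poly h₁), norm_eq h, norm_eq h₁]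
  simp [coeff_one]

theorem skewBilinForm_poly_succ_pos (h : IsJacksonWeight q (weight q α β))
    (h₁ : IsJacksonWeight q (weight q (α + 1) (β + 1))) (hβ : -1 < β) (n : ℕ) :
    0 < h₁.skewBilinForm (poly q α β n) (poly q α β (n + 1)) := by
  rw [skewBilinForm_poly_succ h h₁ hβ]
  have hq : 0 < 1 - q := sub_pos.2 h.q_lt_one
  have hsucc : 0 < qNumber q (n + 1) :=
    div_pos (sub_pos.2 (pow_lt_one₀ h.q_pos.le h.q_lt_one n.succ_ne_zero)) hq
  have hself : 0 ≤ qNumber q n :=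
    div_nonneg (sub_nonneg.2 (pow_le_one₀ h.q_pos.le h.q_lt_one.le)) hq.le
  exact add_pos_of_pos_of_nonneg (mul_pos hsucc (norm_pos h₁ n))
    (mul_nonneg (mul_nonneg (Real.rpow_nonneg h.q_pos.le _) hself) (norm_pos h _).le)

theorem prod_Icc_one_succ {M : Type*} [CommMonoid M] (f : ℕ → M) (n : ℕ) :
    ∏ k ∈ Finset.Icc 1 (n + 1), f k = f 1 * ∏ k ∈ Finset.Icc 1 n, f (k + 1) := by
  induction n with
  | zero => simp
  | succ n ih =>
    rw [Finset.prod_Icc_succ_top (by omega), ih, Finset.prod_Icc_succ_top (by omega), mul_assoc]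

theorem skewEven_succ (q α β : ℝ) (m : ℕ) :
    skewEven q α β (m + 1) = poly q α β (2 * m + 2) +
      ((qNumber q (2 * m + 2) * norm q (α + 1) (β + 1) (2 * m + 1) +
          q ^ (β + 1) * qNumber q (2 * m + 1) * norm q α β (2 * m + 2)) /
        (qNumber q (2 * m + 1) * norm q (α + 1) (β + 1) (2 * m) +
          q ^ (β + 1) * qNumber q (2 * m) * norm q α β (2 * m + 1))) • skewEven q α β m := by
  rw [skewEven, Finset.sum_range_succ, add_comm, skewEven, Finset.smul_sum]
  congr 1
  · simp [mul_add]
  · refine Finset.sum_congr rfl fun j hj => ?_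
    have hsub : m + 1 - j = m - j + 1 := by
      have := Finset.mem_range.1 hj
      omega
    have hshift (k : ℕ) : 2 * m + 2 - (2 * k + 2) = 2 * m - 2 * k := Nat.add_sub_add_right ..
    rw [hsub, prod_Icc_one_succ, C_mul, mul_assoc, ← smul_eq_C_mul]
    simp only [Nat.mul_succ, mul_one, Nat.add_sub_cancel, hshift]

theorem skewEven_eq_skewEvenPart (h : IsJacksonWeight q (weight q α β))
    (h₁ : IsJacksonWeight q (weight q (α + 1) (β + 1))) (hβ : -1 < β) (m : ℕ) :
    skewEven q α β m =
      skewEvenPart h₁.skewBilinForm (poly q α β) m := by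
  induction m with
  | zero => simp [skewEven, skewEvenPart]
  | succ m ih =>
    rw [skewEven_succ, skewEvenPart, ih, skewBilinForm_poly_succ h h₁ hβ,
      skewBilinForm_poly_succ h h₁ hβ]

theorem isTridiagonal_poly (h : IsJacksonWeight q (weight q α β))
    (h₁ : IsJacksonWeight q (weight q (α + 1) (β + 1))) (hβ : -1 < β) :
    IsTridiagonal h₁.skewBilinForm (poly q α β) :=
  (isPearsonPair_weight h.q_pos h.q_lt_one α hβ).isTridiagonal (isMonicOrthogonalSeq_poly h)

theorem isMonicSkewOrthogonalSeq_skewGramSchmidt_poly (h : IsJacksonWeight q (weight q α β))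
    (h₁ : IsJacksonWeight q (weight q (α + 1) (β + 1))) (hβ : -1 < β) :
    IsMonicSkewOrthogonalSeq h₁.skewBilinForm (skewGramSchmidt h₁.skewBilinForm (poly q α β)) :=
  ⟨(isMonicSeq_poly q α β).skewGramSchmidt,
    (isTridiagonal_poly h h₁ hβ).isSkewOrthogonal_skewGramSchmidt (isAlt_wronskianForm _ _)
      fun n => (skewBilinForm_poly_succ_pos h h₁ hβ (2 * n)).ne'⟩

theorem skewBilinForm_skewGramSchmidt_poly_ne_zero (h : IsJacksonWeight q (weight q α β))
    (h₁ : IsJacksonWeight q (weight q (α + 1) (β + 1))) (hβ : -1 < β) (n : ℕ) :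
    h₁.skewBilinForm (skewGramSchmidt h₁.skewBilinForm (poly q α β) (2 * n))
      (skewGramSchmidt h₁.skewBilinForm (poly q α β) (2 * n + 1)) ≠ 0 := by
  have hne (n : ℕ) := (skewBilinForm_poly_succ_pos h h₁ hβ (2 * n)).ne'
  rw [(isTridiagonal_poly h h₁ hβ).skewGramSchmidt_apply_succ (isAlt_wronskianForm _ _) hne]
  exact hne n

end LittleQJacobiPolynomials

end LittleQJacobi

end

theorem mainTheorem11 (q α β : ℝ) (hq0 : 0 < q) (hq1 : q < 1) (hα : -1 < α) (hβ : -1 < β) :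
    -- the polynomials `p_n^{(α,β)}` are the unique monic orthogonal polynomials of `ω^{(α,β)}`
    (∀ p : ℕ → Polynomial ℝ,
      LittleQJacobi.IsMonicOrthogonal q (LittleQJacobi.weight q α β) p ↔
        p = LittleQJacobi.poly q α β) ∧
    -- the explicit family is skew orthogonal for `ω^{(α+1,β+1)}`, with nonzero normalisations
    (∀ Q : ℕ → Polynomial ℝ,
      (∀ m, Q (2 * m + 1) = LittleQJacobi.poly q α β (2 * m + 1)) →
      (∀ m, Q (2 * m) = LittleQJacobi.skewEven q α β m) →
      ∃ u : ℕ → ℝ, (∀ n, u n ≠ 0) ∧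
        LittleQJacobi.IsMonicSkewOrthogonal q (LittleQJacobi.weight q (α + 1) (β + 1)) Q u) ∧
    -- and it is the only one, up to adding multiples of `Q_{2m}` to `Q_{2m+1}`
    (∀ Q : ℕ → Polynomial ℝ,
      (∃ u : ℕ → ℝ,
        LittleQJacobi.IsMonicSkewOrthogonal q (LittleQJacobi.weight q (α + 1) (β + 1)) Q u) ↔
      ∀ m, Q (2 * m) = LittleQJacobi.skewEven q α β m ∧
        ∃ γ : ℝ, Q (2 * m + 1) =
          LittleQJacobi.poly q α β (2 * m + 1) +
            Polynomial.C γ * LittleQJacobi.skewEven q α β m) := by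
  have h := LittleQJacobi.isJacksonWeight_weight hq0 hq1 hα hβ
  have h₁ : LittleQJacobi.IsJacksonWeight q (LittleQJacobi.weight q (α + 1) (β + 1)) :=
    LittleQJacobi.isJacksonWeight_weight hq0 hq1 (by linarith) (by linarith)
  have hskew := LittleQJacobi.isMonicSkewOrthogonalSeq_skewGramSchmidt_poly h h₁ hβ
  have hne := LittleQJacobi.skewBilinForm_skewGramSchmidt_poly_ne_zero h h₁ hβ
  have heven := LittleQJacobi.skewEven_eq_skewEvenPart h h₁ hβ
  refine ⟨fun p => LittleQJacobi.isMonicOrthogonal_iff_eq_poly h, fun Q hQodd hQeven => ?_,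
    fun Q => ?_⟩
  · obtain rfl : Q = LittleQJacobi.skewGramSchmidt h₁.skewBilinForm (LittleQJacobi.poly q α β) := by
      funext n
      obtain ⟨m, rfl | rfl⟩ := n.even_or_odd'
      · rw [hQeven, heven, LittleQJacobi.skewGramSchmidt_two_mul]
      · rw [hQodd, LittleQJacobi.skewGramSchmidt_two_mul_add_one]
    exact ⟨_, hne, h₁.isMonicSkewOrthogonal_iff.2 ⟨hskew, fun _ => rfl⟩⟩
  · simp only [h₁.isMonicSkewOrthogonal_iff, exists_and_left, ← funext_iff, exists_eq', and_true,
      hskew.iff_eq_and_exists_add_C_mul (LittleQJacobi.isAlt_wronskianForm _ _) hne, heven,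
      LittleQJacobi.skewGramSchmidt_two_mul, LittleQJacobi.skewGramSchmidt_two_mul_add_one]
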